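/- Let $k$ be a field and $\Pi$ a finite poset. A \emph{sheaf} $F$ on $\Pi$ consists of a finite-dimensional $k$-vector space $F(\pi)$ for each $\pi\in\Pi$ and linear maps $F(\pi\le\tau):F(\pi)\to F(\tau)$ for $\pi\le\tau$, with $F(\pi\le\pi)=\mathrm{id}$ and $F(\tau\le\gamma)\circ F(\pi\le\tau)=F(\pi\le\gamma)$; morphisms of sheaves are natural transformations. A sheaf $I$ is \emph{injective} if for every pointwise injective morphism $A\to B$ of sheaves each morphism $A\to I$ extends to $B$. A vector $s\in F(\pi)$ is \emph{maximal} if $F(\pi\le\tau)(s)=0$ for every $\tau>\pi$. All complexes $(A^d,\mu^d)_{d\in\mathbb Z}$ of sheaves, $\mu^d:A^d\to A^{d+1}$, are bounded, i.e. $A^d=0$ for $|d|$ sufficiently large. Two complexes are \emph{quasi-isomorphic} if they are connected by a finite zigzag of quasi-isomorphisms of complexes. A complex $I^\bullet$ of injective sheaves is \emph{minimal} if for every complex $J^\bullet$ of injective sheaves quasi-isomorphic to $I^\bullet$ and every $d$, the number of indecomposable summands of $I^d$ (in a decomposition as a finite direct sum of indecomposable sheaves) is at most that of $J^d$. An \emph{injective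 resolution} of a complex $F^\bullet$ is a quasi-isomorphism $F^\bullet\to I^\bullet$ to a complex $I^\bullet$ of injective sheaves. \textbf{Theorem.} Let $(I^\bullet,\eta^\bullet)$ be a complex of injective sheaves on $\Pi$. The following are equivalent: \begin{enumerate} \item $I^\bullet$ is minimal. \item For every complex $J^\bullet$ of injective sheaves quasi-isomorphic to $I^\bullet$ there exists a morphism of complexes $r^\bullet:J^\bullet\to I^\bullet$ such that $r^d$ is (pointwise) surjective for each $d$. \item For every complex $J^\bullet$ of injective sheaves quasi-isomorphic to $I^\bullet$ there exists a morphism of complexes $q^\bullet:I^\bullet\to J^\bullet$ such that $q^d$ is (pointwise) injective for each $d$. \item For each $d$, each $\pi\in\Pi$ and each maximal vector $s\in I^d(\pi)$, $\eta^d(\pi)(s)=0$. \end{enumerate} Moreover, every complex $F^\bullet$ of sheaves on $\Pi$ has an injective resolution $F^\bullet\to I^\bullet$ with $I^\bullet$ minimal, and for any two such resolutions $F^\bullet\to I^\bullet$ and $F^\bullet\to J^\bullet$ the complexes $I^\bullet$ and $J^\bullet$ are isomorphic. -/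

import Mathlib

open CategoryTheory CategoryTheory.Limits

universe u w

/-- Sheaves of finite-dimensional `k`-vector spaces on a poset `P`: a finite-dimensional vector
space `F(π)` for every `π : P`, and linear maps `F(τ ≤ γ)`, functorial in the relations of `P`. -/
abbrev PosetSheaf (k : Type u) [Field k] (P : Type w) [PartialOrder P] :=
  P ⥤ FGModuleCat.{u} k

/-- Complexes of sheaves on `P`, indexed by `ℤ`, with differential of degree `+1`. -/
abbrev SheafComplex (k : Type u) [Field k] (P : Type w) [PartialOrder P] :=
  CochainComplex (PosetSheaf k P) ℤ

namespace PosetSheaf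

variable {k : Type u} [Field k] {P : Type w} [PartialOrder P]

instance : HasFiniteBiproducts (PosetSheaf k P) := Abelian.hasFiniteBiproducts

/-- A vector `s ∈ F(π)` is maximal if `F(π ≤ τ)(s) = 0` for every `τ > π`. -/
def IsMaximalVector (F : PosetSheaf k P) (π : P) (s : F.obj π) : Prop :=
  ∀ (τ : P) (h : π < τ), F.map (homOfLE h.le) s = 0

/-- `F` is isomorphic to a direct sum of `n` indecomposable sheaves. -/
def HasIndecomposableDecomposition (F : PosetSheaf k P) (n : ℕ) : Prop :=
  ∃ X : Fin n → PosetSheaf k P, (∀ i, Indecomposable (X i)) ∧ Nonempty (F ≅ ⨁ X)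

/-- The number of indecomposable summands of `F`. On a finite poset a decomposition into
indecomposables exists and the number of its summands does not depend on the decomposition
(Krull-Schmidt), so that the infimum below is over a one-element set. -/
noncomputable def numIndecomposableSummands (F : PosetSheaf k P) : ℕ :=
  sInf {n : ℕ | F.HasIndecomposableDecomposition n}

end PosetSheaf

namespace SheafComplex

variable {k : Type u} [Field k] {P : Type w} [PartialOrder P]

/-- `K^d = 0` for `|d|` sufficiently large. -/
def IsBounded (K : SheafComplex k P) : Prop :=
  ∃ N : ℤ, ∀ d : ℤ, N < |d| → IsZero (K.X d)

/-- Bounded complexes of injective sheaves. -/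
structure IsInjectiveComplex (I : SheafComplex k P) : Prop where
  bounded : IsBounded I
  injective : ∀ d : ℤ, Injective (I.X d)

/-- Two complexes are quasi-isomorphic if they are connected by a finite zigzag of
quasi-isomorphisms of bounded complexes. -/
def QuasiIsomorphic (K L : SheafComplex k P) : Prop :=
  Relation.EqvGen
    (fun A B : SheafComplex k P => IsBounded A ∧ IsBounded B ∧ ∃ f : A ⟶ B, QuasiIso f) K L

/-- Minimal complexes of injective sheaves. -/
structure IsMinimal (I : SheafComplex k P) : Prop where
  isInjectiveComplex : IsInjectiveComplex I
  le : ∀ J : SheafComplex k P, IsInjectiveComplex J → QuasiIsomorphic I J →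
    ∀ d : ℤ, (I.X d).numIndecomposableSummands ≤ (J.X d).numIndecomposableSummands

/-- An injective resolution of `F` is a quasi-isomorphism from `F` to a bounded complex of
injective sheaves. -/
structure IsInjectiveResolution {F I : SheafComplex k P} (α : F ⟶ I) : Prop where
  isInjectiveComplex : IsInjectiveComplex I
  quasiIso : QuasiIso α

end SheafComplex

/-! Everything is governed by maximal vectors, the socle of a sheaf. On a finite poset every nonzero
vector has a nonzero maximal image further up, so a morphism injective on maximal vectors is a
monomorphism. An injective sheaf is a finite sum of sheaves `indecInjective k π`, each with a
one-dimensional socle; hence its number of indecomposable summands is `socleDim`.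

Conditions 1, 2 and 3 are all compared with 4. Bounded complexes of injectives are K-injective, so
quasi-isomorphic ones are homotopy equivalent. Under 4, an endomorphism homotopic to the identity is
the identity on maximal vectors, hence an isomorphism (`VanishesOnMaximalVectors.isIso`). So `I` is,
up to an automorphism, a retract of every quasi-isomorphic injective complex; this gives 1, 2, 3 and
uniqueness.

If 4 fails at `s`, then `s` generates an `indecInjective k π` on which the differential is split
injective, and a contractible summand splits off (`exists_retract_socleDim_lt`). Iterating reaches a
complex with 4, which each of 1, 2, 3 forces to be isomorphic to `I`.

Resolutions come from enlarging an upper set on which the complex is acyclic, one point at a time,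
by the cone of the unit to a coinduced complex. -/

namespace FGModuleCat

variable {k : Type u} [Field k]

lemma mono_iff_injective {V W : FGModuleCat.{u} k} (f : V ⟶ W) :
    Mono f ↔ Function.Injective f := by
  constructor
  · intro _
    exact (ModuleCat.mono_iff_injective ((forget₂ (FGModuleCat k) (ModuleCat k)).map f)).1
      inferInstance
  · exact ConcreteCategory.mono_of_injective f

lemma isIso_of_bijective {V W : FGModuleCat.{u} k} (f : V ⟶ W) (hf : Function.Bijective f) :
    IsIso f :=
  (LinearEquiv.ofBijective f.hom.hom hf).toFGModuleCatIso.isIso_hom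

instance injective (V : FGModuleCat.{u} k) : Injective V where
  factors {X Y} g f _ := by
    obtain ⟨h, hh⟩ := LinearMap.exists_leftInverse_of_injective f.hom.hom
      (LinearMap.ker_eq_bot.2 ((mono_iff_injective f).1 inferInstance))
    refine ⟨FGModuleCat.ofHom (g.hom.hom ∘ₗ h), ?_⟩
    ext x
    exact congrArg g (LinearMap.congr_fun hh x)

end FGModuleCat

namespace PosetSheaf

variable {k : Type u} [Field k] {P : Type w} [PartialOrder P]

section Pointwise

variable {F G H : PosetSheaf k P}

lemma comp_app_apply (f : F ⟶ G) (g : G ⟶ H) (π : P) (x : F.obj π) :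
    (f ≫ g).app π x = g.app π (f.app π x) := rfl

lemma id_app_apply (π : P) (x : F.obj π) : (𝟙 F : F ⟶ F).app π x = x := rfl

lemma add_app_apply (f g : F ⟶ G) (π : P) (x : F.obj π) :
    (f + g).app π x = f.app π x + g.app π x := rfl

lemma zero_app_apply (π : P) (x : F.obj π) : (0 : F ⟶ G).app π x = 0 := rfl

lemma map_map_apply {π τ σ : P} (h : π ≤ τ) (h' : τ ≤ σ) (x : F.obj π) :
    F.map (homOfLE h') (F.map (homOfLE h) x) = F.map (homOfLE (h.trans h')) x := by
  rw [← homOfLE_comp h h', F.map_comp]; rfl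

lemma map_refl_apply {π : P} (x : F.obj π) : F.map (homOfLE (le_refl π)) x = x := by
  change F.map (𝟙 π) x = x
  rw [F.map_id]; rfl

lemma mono_iff_injective (f : F ⟶ G) : Mono f ↔ ∀ π, Function.Injective (f.app π) := by
  simp only [NatTrans.mono_iff_mono_app, FGModuleCat.mono_iff_injective]

lemma isIso_of_mono_of_finrank_le (f : F ⟶ G) [Mono f]
    (h : ∀ π, Module.finrank k (G.obj π) ≤ Module.finrank k (F.obj π)) : IsIso f := by
  have hinj := (mono_iff_injective f).1 inferInstance
  have (π : P) : IsIso (f.app π) := by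
    have hd : Module.finrank k (F.obj π) = Module.finrank k (G.obj π) :=
      le_antisymm (LinearMap.finrank_le_finrank_of_injective (f := (f.app π).hom.hom) (hinj π))
        (h π)
    exact FGModuleCat.isIso_of_bijective _ ⟨hinj π,
      (LinearMap.injective_iff_surjective_of_finrank_eq_finrank (f := (f.app π).hom.hom) hd).1
        (hinj π)⟩
  exact NatIso.isIso_of_isIso_app f

lemma isIso_of_surjective_of_finrank_le (f : F ⟶ G)
    (hf : ∀ π, Function.Surjective (f.app π))
    (h : ∀ π, Module.finrank k (F.obj π) ≤ Module.finrank k (G.obj π)) : IsIso f := by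
  have (π : P) : IsIso (f.app π) := by
    have hd : Module.finrank k (F.obj π) = Module.finrank k (G.obj π) :=
      le_antisymm (h π)
        (LinearMap.finrank_le_finrank_of_surjective (f := (f.app π).hom.hom) (hf π))
    exact FGModuleCat.isIso_of_bijective _
      ⟨(LinearMap.injective_iff_surjective_of_finrank_eq_finrank (f := (f.app π).hom.hom) hd).2
        (hf π), hf π⟩
  exact NatIso.isIso_of_isIso_app f

end Pointwise

/-! ### Maximal vectors and the socle dimension -/

section Maximal

variable {F G : PosetSheaf k P}

lemma IsMaximalVector.map {π : P} {s : F.obj π} (hs : IsMaximalVector F π s) (f : F ⟶ G) :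
    IsMaximalVector G π (f.app π s) := fun τ h => by
  rw [← NatTrans.naturality_apply, hs τ h, map_zero]

/-- The subspace of maximal vectors of `F(π)`. -/
def maximalVectors (F : PosetSheaf k P) (π : P) : Submodule k (F.obj π) where
  carrier := {s | IsMaximalVector F π s}
  add_mem' := fun hx hy τ h => by rw [map_add, hx τ h, hy τ h, add_zero]
  zero_mem' τ h := map_zero _
  smul_mem' c _ hx τ h := by rw [map_smul, hx τ h, smul_zero]

lemma mem_maximalVectors {π : P} {s : F.obj π} :
    s ∈ maximalVectors F π ↔ IsMaximalVector F π s := Iff.rfl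

/-- Push `x` upwards as far as its image stays nonzero. -/
lemma exists_isMaximalVector_map [Finite P] {π : P} {x : F.obj π} (hx : x ≠ 0) :
    ∃ (τ : P) (h : π ≤ τ), IsMaximalVector F τ (F.map (homOfLE h) x) ∧
      F.map (homOfLE h) x ≠ 0 := by
  obtain ⟨τ, ⟨h, h0⟩, hmax⟩ :=
    (Set.toFinite {τ : P | ∃ h : π ≤ τ, F.map (homOfLE h) x ≠ 0}).exists_maximal
      ⟨π, le_rfl, by rwa [map_refl_apply]⟩
  refine ⟨τ, h, fun σ hσ => ?_, h0⟩
  rw [map_map_apply]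
  by_contra h1
  exact hσ.not_ge (hmax ⟨h.trans hσ.le, h1⟩ hσ.le)

lemma mono_of_isMaximalVector [Finite P] (f : F ⟶ G)
    (hf : ∀ (π : P) (s : F.obj π), IsMaximalVector F π s → f.app π s = 0 → s = 0) : Mono f := by
  rw [mono_iff_injective]
  intro π
  rw [injective_iff_map_eq_zero]
  intro x hx
  by_contra h0
  obtain ⟨τ, h, hm, hne⟩ := exists_isMaximalVector_map h0
  exact hne (hf τ _ hm (by rw [NatTrans.naturality_apply, hx, map_zero]))

/-- The linear map induced by a morphism of sheaves on maximal vectors. -/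
def maximalVectorsMap (f : F ⟶ G) (π : P) : maximalVectors F π →ₗ[k] maximalVectors G π :=
  (f.app π).hom.hom.restrict fun _ hs => IsMaximalVector.map hs f

lemma maximalVectorsMap_injective (f : F ⟶ G) [Mono f] (π : P) :
    Function.Injective (maximalVectorsMap f π) := fun _ _ h =>
  Subtype.ext ((mono_iff_injective f).1 inferInstance π (congrArg Subtype.val h))

variable (k P) in
/-- The functor of maximal vectors at `π`. -/
def maximalVectorsFunctor (π : P) : PosetSheaf k P ⥤ ModuleCat.{u} k where
  obj F := ModuleCat.of k (maximalVectors F π)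
  map f := ModuleCat.ofHom (maximalVectorsMap f π)

instance (π : P) : (maximalVectorsFunctor k P π).Additive where

/-- The total dimension of the spaces of maximal vectors of `F`. -/
noncomputable def socleDim (F : PosetSheaf k P) : ℕ :=
  ∑ᶠ π : P, Module.finrank k (maximalVectors F π)

lemma socleDim_le_of_mono [Finite P] (f : F ⟶ G) [Mono f] : socleDim F ≤ socleDim G :=
  finsum_le_finsum' (Set.toFinite _) (Set.toFinite _) fun π =>
    LinearMap.finrank_le_finrank_of_injective (maximalVectorsMap_injective f π)

lemma socleDim_eq_of_iso (e : F ≅ G) : socleDim F = socleDim G :=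
  finsum_congr fun π => ((maximalVectorsFunctor k P π).mapIso e).toLinearEquiv.finrank_eq

/-- A monomorphism can only raise the dimension at each point, so the inequality of the sums forces
equality termwise. -/
lemma maximalVectorsMap_surjective_of_socleDim_le [Finite P] (f : F ⟶ G) [Mono f]
    (h : socleDim G ≤ socleDim F) (π : P) : Function.Surjective (maximalVectorsMap f π) := by
  have hle (τ : P) : Module.finrank k (maximalVectors F τ) ≤ Module.finrank k (maximalVectors G τ) :=
    LinearMap.finrank_le_finrank_of_injective (maximalVectorsMap_injective f τ)
  have heq : Module.finrank k (maximalVectors F π) = Module.finrank k (maximalVectors G π) := by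
    have := Fintype.ofFinite P
    rw [socleDim, socleDim, finsum_eq_sum_of_fintype, finsum_eq_sum_of_fintype] at h
    exact (Finset.sum_eq_sum_iff_of_le fun τ _ => hle τ).1
      (le_antisymm (Finset.sum_le_sum fun τ _ => hle τ) h) π (Finset.mem_univ π)
  exact (LinearMap.injective_iff_surjective_of_finrank_eq_finrank heq).1
    (maximalVectorsMap_injective f π)

lemma isZero_iff_forall_eq_zero : IsZero F ↔ ∀ (π : P) (x : F.obj π), x = 0 := by
  rw [IsZero.iff_id_eq_zero]
  constructor
  · intro h π x
    rw [← id_app_apply π x, h, zero_app_apply]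
  · intro h
    ext π x
    exact h π _

lemma socleDim_eq_zero_iff [Finite P] : socleDim F = 0 ↔ IsZero F := by
  rw [isZero_iff_forall_eq_zero]
  constructor
  · intro h π x
    by_contra hx
    obtain ⟨τ, hτ, hm, h0⟩ := exists_isMaximalVector_map hx
    have := Submodule.finrank_eq_zero.1 (Nat.le_zero.1
      ((single_le_finsum τ (Set.toFinite _) fun _ => Nat.zero_le _).trans h.le))
    exact h0 ((Submodule.mem_bot k).1 (this ▸ mem_maximalVectors.2 hm))
  · intro h
    refine finsum_eq_zero_of_forall_eq_zero fun π => ?_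
    exact Submodule.finrank_eq_zero.2 ((Submodule.eq_bot_iff _).2 fun x _ => h π x)

/-- Injectivity of `F` gives a retraction `r` of `f`. As `f` hits every maximal vector, `r` is
injective on them, so it is a split epimorphism that is also mono. -/
lemma isIso_of_mono_of_socleDim_le [Finite P] [Injective F] (f : F ⟶ G) [Mono f]
    (h : socleDim G ≤ socleDim F) : IsIso f := by
  have hr : f ≫ Injective.factorThru (𝟙 F) f = 𝟙 F := Injective.comp_factorThru _ _
  set r := Injective.factorThru (𝟙 F) f
  have : Mono r := by
    refine mono_of_isMaximalVector r fun π s hs h0 => ?_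
    obtain ⟨t, ht⟩ := maximalVectorsMap_surjective_of_socleDim_le f h π ⟨s, hs⟩
    have ht' : f.app π t = s := congrArg Subtype.val ht
    have : r.app π (f.app π t) = t := by rw [← comp_app_apply, hr]; rfl
    rw [ht', h0] at this
    rw [← ht', ← this, map_zero]
  exact ⟨r, hr, by rw [← cancel_mono r, Category.assoc, hr, Category.comp_id, Category.id_comp]⟩

end Maximal

end PosetSheaf

namespace PosetSheaf

variable {k : Type u} [Field k] {P : Type w} [PartialOrder P]

/-! ### Coinduced sheaves -/

section Coinduced

/-- The sheaf with value `V` at every `τ ≤ π` and `0` elsewhere, functorially in `V`. -/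
def coind (π : P) : FGModuleCat.{u} k ⥤ PosetSheaf k P where
  obj V :=
    -- Functions on a proposition: `V` if `τ ≤ π`, and the zero space otherwise, without a case
    -- split.
    { obj τ := FGModuleCat.of k (PLift (τ ≤ π) → V)
      map f := FGModuleCat.ofHom
        (LinearMap.funLeft k V fun h => ⟨(leOfHom f).trans h.down⟩) }
  map φ := { app τ := FGModuleCat.ofHom (LinearMap.compLeft φ.hom.hom _) }

variable {F : PosetSheaf k P} {π : P} {V : FGModuleCat.{u} k}

/-- The value of a section of `coind π V` at `π`. -/
def coindEval {τ : P} (h : τ ≤ π) : (((coind π).obj V).obj τ : Type u) →ₗ[k] V :=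
  LinearMap.proj (φ := fun _ : PLift (τ ≤ π) => V) ⟨h⟩

lemma coind_ext {τ : P} {x y : ((coind π).obj V).obj τ}
    (h : ∀ h : τ ≤ π, coindEval h x = coindEval h y) : x = y :=
  funext fun h' => h h'.down

lemma coindEval_map {τ σ : P} (h : τ ≤ σ) (h' : σ ≤ π) (x : ((coind π).obj V).obj τ) :
    coindEval h' (((coind π).obj V).map (homOfLE h) x) = coindEval (h.trans h') x := rfl

instance (π : P) : (coind (k := k) π).Additive where

/-- The morphism into `coind π V` with given value at `π`. -/
def coindLift (φ : F.obj π ⟶ V) : F ⟶ (coind π).obj V where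
  app τ := FGModuleCat.ofHom
    (LinearMap.pi fun h : PLift (τ ≤ π) => (F.map (homOfLE h.down) ≫ φ).hom.hom)
  naturality τ σ h := by
    ext x
    funext h'
    exact congrArg φ (map_map_apply (leOfHom h) h'.down x)

lemma coindEval_coindLift {τ : P} (φ : F.obj π ⟶ V) (h : τ ≤ π) (x : F.obj τ) :
    coindEval h ((coindLift φ).app τ x) = φ (F.map (homOfLE h) x) := rfl

lemma coindEval_app {τ : P} (f : F ⟶ (coind π).obj V) (h : τ ≤ π) (x : F.obj τ) :
    coindEval h (f.app τ x) = coindEval le_rfl (f.app π (F.map (homOfLE h) x)) := by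
  rw [NatTrans.naturality_apply, coindEval_map]

lemma coind_hom_ext {f g : F ⟶ (coind π).obj V}
    (h : ∀ x, coindEval le_rfl (f.app π x) = coindEval le_rfl (g.app π x)) : f = g := by
  ext τ x
  exact coind_ext fun hτ =>
    (coindEval_app f hτ x).trans ((h _).trans (coindEval_app g hτ x).symm)

variable (k) in
/-- Evaluation at `π` is left adjoint to `coind π`. -/
def coindAdjunction (π : P) :
    (evaluation P (FGModuleCat.{u} k)).obj π ⊣ coind (k := k) π :=
  Adjunction.mkOfHomEquiv
    { homEquiv F V :=
        { toFun φ := coindLift φ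
          invFun f := f.app π ≫ FGModuleCat.ofHom (coindEval le_rfl)
          left_inv φ := by
            ext x
            exact congrArg φ (map_refl_apply x)
          right_inv f := coind_hom_ext fun x => by
            rw [coindEval_coindLift, map_refl_apply]
            rfl }
      homEquiv_naturality_left_symm := fun f g => by ext x; rfl
      homEquiv_naturality_right := fun f g => by ext τ x; rfl }

/-- Evaluation preserves monomorphisms and every vector space is injective, so its right adjoint has
injective values. -/
instance (V : FGModuleCat.{u} k) : Injective ((coind π).obj V) :=
  Injective.injective_of_adjoint (coindAdjunction k π) V

end Coinduced

/-! ### Indecomposable injectives generated by maximal vectors -/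

section InjectiveHull

variable {I F : PosetSheaf k P} {π : P}

variable (k) in
/-- The indecomposable injective sheaf attached to `π`. -/
abbrev indecInjective (π : P) : PosetSheaf k P := (coind π).obj (FGModuleCat.of k k)

variable (k) in
/-- The generator of the space of maximal vectors of `indecInjective k π`. -/
def indecInjectiveOne (π : P) : (indecInjective k π).obj π := fun _ => (1 : k)

lemma coindEval_indecInjectiveOne : coindEval le_rfl (indecInjectiveOne k π) = (1 : k) := rfl

lemma eq_smul_indecInjectiveOne (x : (indecInjective k π).obj π) :
    x = (show k from coindEval le_rfl x) • indecInjectiveOne k π := by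
  refine coind_ext fun h => ?_
  rw [map_smul, coindEval_indecInjectiveOne]
  exact (mul_one _).symm

lemma exists_apply_eq_one {V : FGModuleCat.{u} k} {s : V} (hs : s ≠ 0) :
    ∃ φ : V ⟶ FGModuleCat.of k k, φ s = (1 : k) := by
  obtain ⟨f, hf⟩ := Module.Projective.exists_dual_ne_zero k hs
  refine ⟨FGModuleCat.ofHom ((f s)⁻¹ • f), ?_⟩
  exact inv_mul_cancel₀ hf

/-- The subsheaf of `F` given by a family of subspaces stable under the structure maps. -/
def subsheaf (F : PosetSheaf k P) (W : ∀ τ, Submodule k (F.obj τ))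
    (hW : ∀ (τ σ : P) (f : τ ⟶ σ), ∀ x ∈ W τ, F.map f x ∈ W σ) : PosetSheaf k P where
  obj τ := FGModuleCat.of k (W τ)
  map {τ σ} f := FGModuleCat.ofHom ((F.map f).hom.hom.restrict (hW τ σ f))
  map_id τ := FGModuleCat.hom_ext (LinearMap.ext fun x : W τ => Subtype.ext
    (congrArg (fun f => f x.1) (F.map_id τ)))
  map_comp f g := FGModuleCat.hom_ext (LinearMap.ext fun x : W _ => Subtype.ext
    (congrArg (fun f => f x.1) (F.map_comp f g)))

/-- The inclusion of a subsheaf. -/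
def subsheafι (F : PosetSheaf k P) (W : ∀ τ, Submodule k (F.obj τ))
    (hW : ∀ (τ σ : P) (f : τ ⟶ σ), ∀ x ∈ W τ, F.map f x ∈ W σ) : subsheaf F W hW ⟶ F where
  app τ := FGModuleCat.ofHom (W τ).subtype

/-- Maximality of `s` makes the subsheaf it generates a line concentrated at `π`. This subsheaf also
embeds in `indecInjective k π`, and its inclusion in `I` extends along that embedding. -/
lemma exists_indecInjective_hom [Injective I] {s : I.obj π} (hs : IsMaximalVector I π s)
    (hs0 : s ≠ 0) : ∃ u : indecInjective k π ⟶ I, u.app π (indecInjectiveOne k π) = s := by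
  let W (τ : P) : Submodule k (I.obj τ) :=
    Submodule.span k {x : I.obj τ | ∃ h : π ≤ τ, x = I.map (homOfLE h) s}
  have hW (τ σ : P) (f : τ ⟶ σ) : ∀ x ∈ W τ, I.map f x ∈ W σ := by
    intro x hx
    induction hx using Submodule.span_induction with
    | mem x hx =>
      obtain ⟨h, rfl⟩ := hx
      exact Submodule.subset_span ⟨h.trans (leOfHom f), map_map_apply h (leOfHom f) s⟩
    | zero => rw [map_zero]; exact zero_mem _
    | add x y _ _ hx hy => rw [map_add]; exact add_mem hx hy
    | smul c x _ hx => rw [map_smul]; exact Submodule.smul_mem _ _ hx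
  obtain ⟨φ, hφ⟩ := exists_apply_eq_one hs0
  let ι := subsheafι I W hW
  let t : (subsheaf I W hW).obj π :=
    ⟨s, Submodule.subset_span ⟨le_rfl, (map_refl_apply s).symm⟩⟩
  have ht : ι.app π t = s := rfl
  have hone : (ι ≫ coindLift φ).app π t = indecInjectiveOne k π := by
    refine coind_ext fun h => ?_
    rw [comp_app_apply, ht, coindEval_coindLift, map_refl_apply, hφ]
    rfl
  have : Mono (ι ≫ coindLift φ) := by
    rw [mono_iff_injective]
    intro τ
    rw [injective_iff_map_eq_zero]
    intro x hx
    by_cases hτ : τ = π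
    · subst hτ
      obtain ⟨c, hc⟩ : ∃ c : k, x = c • t := by
        have : W τ = Submodule.span k {s} := by
          refine congrArg (Submodule.span k) (Set.ext fun y => ⟨?_, ?_⟩)
          · rintro ⟨h, rfl⟩
            exact map_refl_apply s
          · intro (hy : y = s)
            exact ⟨le_rfl, hy.trans (map_refl_apply s).symm⟩
        have hxs : ι.app τ x ∈ Submodule.span k {s} := this.le x.2
        obtain ⟨c, hc⟩ := Submodule.mem_span_singleton.1 hxs
        exact ⟨c, Subtype.ext hc.symm⟩
      rw [hc, map_smul, hone] at hx
      have := congrArg (coindEval le_rfl) hx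
      rw [map_smul, coindEval_indecInjectiveOne, map_zero] at this
      rw [hc, show c = 0 from (mul_one c).symm.trans this, zero_smul]
    · have : W τ = ⊥ := by
        refine Submodule.span_eq_bot.2 ?_
        rintro y ⟨h, rfl⟩
        exact hs τ (lt_of_le_of_ne h (Ne.symm hτ))
      have hxs : ι.app τ x ∈ (⊥ : Submodule k (I.obj τ)) := this.le x.2
      exact Subtype.ext ((Submodule.mem_bot k).1 hxs)
  refine ⟨Injective.factorThru ι (ι ≫ coindLift φ), ?_⟩
  rw [← hone, ← comp_app_apply, Injective.comp_factorThru, ht]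

/-- A nonzero maximal vector `s` of an injective sheaf whose image under `f` is nonzero spans
an indecomposable injective summand on which `f` is split injective. -/
lemma exists_indecInjective_retraction [Injective I] (f : I ⟶ F) {s : I.obj π}
    (hs : IsMaximalVector I π s) (hs0 : f.app π s ≠ 0) :
    ∃ (u : indecInjective k π ⟶ I) (v : F ⟶ indecInjective k π),
      u.app π (indecInjectiveOne k π) = s ∧ u ≫ f ≫ v = 𝟙 _ := by
  obtain ⟨u, hu⟩ := exists_indecInjective_hom hs (by rintro rfl; exact hs0 (map_zero _))
  obtain ⟨φ, hφ⟩ := exists_apply_eq_one hs0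
  -- Since `φ` takes the value 1 on the image of `s`, the composite fixes the generator, and a
  -- morphism into a coinduced sheaf is determined at `π`.
  refine ⟨u, coindLift φ, hu, coind_hom_ext fun x => ?_⟩
  rw [eq_smul_indecInjectiveOne x, map_smul, map_smul, comp_app_apply, comp_app_apply, hu,
    coindEval_coindLift, map_refl_apply, hφ, map_smul, map_smul]
  rfl

lemma isMaximalVector_indecInjective (x : (indecInjective k π).obj π) :
    IsMaximalVector (indecInjective k π) π x :=
  fun _ h => coind_ext fun h' => absurd h' h.not_ge

/-- Below `π` the structure map to `π` is injective, so no nonzero vector there is maximal; off the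
down-set of `π` the sheaf is zero. -/
lemma socleDim_indecInjective [Finite P] (π : P) : socleDim (indecInjective k π) = 1 := by
  rw [socleDim, finsum_eq_single _ π]
  · rw [finrank_eq_one_iff']
    refine ⟨⟨indecInjectiveOne k π, isMaximalVector_indecInjective _⟩, ?_, ?_⟩
    · intro h
      exact one_ne_zero (congrFun (congrArg Subtype.val h) ⟨le_rfl⟩ : (1 : k) = 0)
    · rintro ⟨x, hx⟩
      exact ⟨_, Subtype.ext (eq_smul_indecInjectiveOne x).symm⟩
  · intro τ hτ
    refine Submodule.finrank_eq_zero.2 ((Submodule.eq_bot_iff _).2 fun x hx => ?_)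
    refine coind_ext fun h => ?_
    have := congrArg (coindEval le_rfl) (hx π (lt_of_le_of_ne h hτ))
    rwa [coindEval_map, map_zero] at this

end InjectiveHull

/-! ### Socle dimension as the number of indecomposable summands -/

section Decomposition

variable {F G : PosetSheaf k P}

lemma socleDim_biprod [Finite P] (F G : PosetSheaf k P) :
    socleDim (F ⊞ G) = socleDim F + socleDim G := by
  rw [socleDim, socleDim, socleDim, ← finsum_add_distrib (Set.toFinite _) (Set.toFinite _)]
  refine finsum_congr fun π => ?_
  rw [← Module.finrank_prod]
  have := preservesBinaryBiproducts_of_preservesBiproducts (maximalVectorsFunctor k P π)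
  exact ((maximalVectorsFunctor k P π).mapBiprod F G ≪≫
    ModuleCat.biprodIsoProd _ _).toLinearEquiv.finrank_eq

lemma socleDim_biproduct [Finite P] {n : ℕ} (X : Fin n → PosetSheaf k P) :
    socleDim (⨁ X) = ∑ i, socleDim (X i) := by
  simp only [socleDim]
  rw [← finsum_sum_comm _ _ fun _ _ => Set.toFinite _]
  refine finsum_congr fun π => ?_
  rw [← Module.finrank_pi_fintype]
  exact ((maximalVectorsFunctor k P π).mapBiproduct X ≪≫
    ModuleCat.biproductIsoPi _).toLinearEquiv.finrank_eq

lemma exists_iso_biprod {E : PosetSheaf k P} (u : E ⟶ F) (v : F ⟶ E) (h : u ≫ v = 𝟙 E) :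
    ∃ G : PosetSheaf k P, Nonempty (F ≅ E ⊞ G) := by
  have : IsSplitMono u := ⟨⟨⟨v, h⟩⟩⟩
  exact ⟨_, ⟨biprod.uniqueUpToIso _ _
    (isBilimitBinaryBiconeOfIsSplitMonoOfCokernel (cokernelIsCokernel u))⟩⟩

lemma exists_iso_indecInjective_biprod [Finite P] [Injective F] (hF : ¬ IsZero F) :
    ∃ (π : P) (G : PosetSheaf k P), Nonempty (F ≅ indecInjective k π ⊞ G) := by
  rw [isZero_iff_forall_eq_zero] at hF
  push Not at hF
  obtain ⟨π, x, hx⟩ := hF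
  obtain ⟨τ, h, hm, h0⟩ := exists_isMaximalVector_map hx
  obtain ⟨u, v, -, huv⟩ := exists_indecInjective_retraction (𝟙 F) hm h0
  rw [Category.id_comp] at huv
  exact ⟨τ, exists_iso_biprod u v huv⟩

/-- The socle dimension is additive and detects zero, so a sheaf of socle dimension 1 cannot split.
-/
lemma indecomposable_indecInjective [Finite P] (π : P) : Indecomposable (indecInjective k π) := by
  constructor
  · rw [← socleDim_eq_zero_iff, socleDim_indecInjective]
    exact one_ne_zero
  · intro Y Z e
    have := socleDim_eq_of_iso e
    rw [socleDim_indecInjective, socleDim_biprod] at this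
    rw [← socleDim_eq_zero_iff, ← socleDim_eq_zero_iff]
    omega

lemma socleDim_eq_one [Finite P] [Injective F] (hF : Indecomposable F) : socleDim F = 1 := by
  obtain ⟨π, G, ⟨e⟩⟩ := exists_iso_indecInjective_biprod hF.1
  have hG : IsZero G := (hF.2 _ _ e).resolve_left (indecomposable_indecInjective π).1
  rw [socleDim_eq_of_iso e, socleDim_biprod, socleDim_indecInjective, socleDim_eq_zero_iff.2 hG]

lemma nonempty_biprod_biproduct_iso {n : ℕ} (E : PosetSheaf k P) (X : Fin n → PosetSheaf k P) :
    Nonempty (E ⊞ ⨁ X ≅ ⨁ (Fin.cons E X : Fin (n + 1) → PosetSheaf k P)) := by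
  let b : Bicone (Fin.cons E X : Fin (n + 1) → PosetSheaf k P) :=
    { pt := E ⊞ ⨁ X
      π := Fin.cases biprod.fst fun i => biprod.snd ≫ biproduct.π X i
      ι := Fin.cases biprod.inl fun i => biproduct.ι X i ≫ biprod.inr
      ι_π := by
        intro i j
        induction i using Fin.cases with
        | zero =>
          induction j using Fin.cases with
          | zero => rw [dif_pos rfl]; exact biprod.inl_fst (X := E) (Y := ⨁ X)
          | succ j =>
            rw [dif_neg (Fin.succ_ne_zero j).symm]
            exact (biprod.inl_snd_assoc (X := E) (Y := ⨁ X) _).trans zero_comp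
        | succ i =>
          induction j using Fin.cases with
          | zero =>
            rw [dif_neg (Fin.succ_ne_zero i)]
            exact (Category.assoc _ _ _).trans
              ((congrArg (biproduct.ι X i ≫ ·) (biprod.inr_fst (X := E))).trans comp_zero)
          | succ j =>
            have : (biproduct.ι X i ≫ biprod.inr) ≫ (biprod.snd : E ⊞ ⨁ X ⟶ _) ≫ biproduct.π X j =
                biproduct.ι X i ≫ biproduct.π X j := by simp
            refine this.trans ?_
            by_cases h : i = j
            · subst h
              rw [dif_pos rfl]
              exact biproduct.ι_π_self X i
            · rw [dif_neg fun h' => h (Fin.succ_injective _ h')]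
              exact biproduct.ι_π_ne X h }
  refine ⟨biproduct.uniqueUpToIso _ (b := b) (isBilimitOfTotal b ?_)⟩
  rw [Fin.sum_univ_succ]
  have h : ∑ i : Fin n, ((biprod.snd : E ⊞ ⨁ X ⟶ _) ≫ biproduct.π X i) ≫
      biproduct.ι X i ≫ (biprod.inr : _ ⟶ E ⊞ ⨁ X) = biprod.snd ≫ biprod.inr := by
    have := congrArg (fun f => (biprod.snd : E ⊞ ⨁ X ⟶ _) ≫ f ≫ (biprod.inr : _ ⟶ E ⊞ ⨁ X))
      (biproduct.total (f := X)).symm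
    simp only [Preadditive.comp_sum, Preadditive.sum_comp, Category.id_comp,
      Category.assoc] at this
    simpa only [Category.assoc] using this.symm
  exact (congrArg (fun f => biprod.fst ≫ biprod.inl + f) h).trans biprod.total

lemma hasIndecomposableDecomposition_socleDim [Finite P] (F : PosetSheaf k P) [Injective F] :
    F.HasIndecomposableDecomposition (socleDim F) := by
  induction hn : socleDim F generalizing F with
  | zero =>
    refine ⟨Fin.elim0, fun i => i.elim0, ⟨(socleDim_eq_zero_iff.1 hn).iso ?_⟩⟩
    rw [← socleDim_eq_zero_iff, socleDim_biproduct, Fin.sum_univ_zero]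
  | succ n ih =>
    have hF : ¬ IsZero F := by rw [← socleDim_eq_zero_iff, hn]; exact n.succ_ne_zero
    obtain ⟨π, G, ⟨e⟩⟩ := exists_iso_indecInjective_biprod hF
    have hG : socleDim G = n := by
      rw [socleDim_eq_of_iso e, socleDim_biprod, socleDim_indecInjective] at hn
      omega
    have : Injective (indecInjective k π ⊞ G) := Injective.of_iso e inferInstance
    have : Injective G :=
      (Retract.mk biprod.inr biprod.snd : Retract G (indecInjective k π ⊞ G)).injective
    obtain ⟨X, hX, ⟨e'⟩⟩ := ih G hG
    obtain ⟨e''⟩ := nonempty_biprod_biproduct_iso (indecInjective k π) X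
    exact ⟨_, Fin.cases (indecomposable_indecInjective π) hX,
      ⟨e ≪≫ biprod.mapIso (Iso.refl _) e' ≪≫ e''⟩⟩

/-- Summands of an injective are injective, so each contributes exactly 1; this replaces
Krull-Schmidt. -/
lemma HasIndecomposableDecomposition.eq_socleDim [Finite P] [Injective F] {n : ℕ}
    (h : F.HasIndecomposableDecomposition n) : n = socleDim F := by
  obtain ⟨X, hX, ⟨e⟩⟩ := h
  have : Injective (⨁ X) := Injective.of_iso e inferInstance
  have (i : Fin n) : Injective (X i) :=
    (Retract.mk (biproduct.ι X i) (biproduct.π X i) : Retract (X i) (⨁ X)).injective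
  rw [socleDim_eq_of_iso e, socleDim_biproduct]
  simp [fun i => socleDim_eq_one (hX i)]

lemma numIndecomposableSummands_eq_socleDim [Finite P] (F : PosetSheaf k P) [Injective F] :
    F.numIndecomposableSummands = socleDim F := by
  have h := hasIndecomposableDecomposition_socleDim F
  exact HasIndecomposableDecomposition.eq_socleDim
    (Nat.sInf_mem (s := {n | F.HasIndecomposableDecomposition n}) ⟨_, h⟩)

end Decomposition

end PosetSheaf

/-! ### Homotopy theory of bounded injective complexes -/

namespace SheafComplex

variable {k : Type u} [Field k] {P : Type w} [PartialOrder P]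

attribute [local instance] HasDerivedCategory.standard

lemma IsInjectiveComplex.isKInjective {I : SheafComplex k P} (hI : IsInjectiveComplex I) :
    CochainComplex.IsKInjective I := by
  obtain ⟨N, hN⟩ := hI.bounded
  have := hI.injective
  -- The absolute value covers a negative `N`.
  have : CochainComplex.IsStrictlyGE I (-|N|) := by
    rw [CochainComplex.isStrictlyGE_iff]
    intro i hi
    refine hN i ?_
    have h1 := le_abs_self N
    have h2 := neg_le_abs i
    linarith
  exact CochainComplex.isKInjective_of_injective I (-|N|)

/-- Into a K-injective complex, derived morphisms agree with homotopy classes of chain maps. -/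
lemma exists_Q_map_eq {K I : SheafComplex k P} [CochainComplex.IsKInjective I]
    (g : DerivedCategory.Q.obj K ⟶ DerivedCategory.Q.obj I) :
    ∃ f : K ⟶ I, DerivedCategory.Q.map f = g := by
  obtain ⟨h, hh⟩ := (CochainComplex.IsKInjective.Qh_map_bijective
    ((HomotopyCategory.quotient _ _).obj K) I).surjective
    ((DerivedCategory.quotientCompQhIso _).hom.app K ≫ g ≫
      (DerivedCategory.quotientCompQhIso _).inv.app I)
  obtain ⟨f, rfl⟩ := (HomotopyCategory.quotient _ _).map_surjective h
  refine ⟨f, ?_⟩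
  rw [← cancel_epi ((DerivedCategory.quotientCompQhIso _).hom.app K),
    ← DerivedCategory.quotientCompQhIso_hom_naturality, hh]
  simp

lemma QuasiIsomorphic.nonempty_Q_iso {K L : SheafComplex k P} (h : QuasiIsomorphic K L) :
    Nonempty (DerivedCategory.Q.obj K ≅ DerivedCategory.Q.obj L) := by
  induction h with
  | rel K L h =>
    obtain ⟨-, -, f, _⟩ := h
    exact ⟨asIso (DerivedCategory.Q.map f)⟩
  | refl K => exact ⟨Iso.refl _⟩
  | symm K L _ h => exact ⟨h.some.symm⟩
  | trans K L M _ _ h h' => exact ⟨h.some ≪≫ h'.some⟩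

lemma QuasiIsomorphic.of_quasiIso {K L : SheafComplex k P} (hK : IsBounded K) (hL : IsBounded L)
    (f : K ⟶ L) (hf : QuasiIso f) : QuasiIsomorphic K L :=
  .rel _ _ ⟨hK, hL, f, hf⟩

lemma QuasiIsomorphic.nonempty_homotopyEquiv {I J : SheafComplex k P} (hI : IsInjectiveComplex I)
    (hJ : IsInjectiveComplex J) (h : QuasiIsomorphic I J) : Nonempty (HomotopyEquiv I J) := by
  obtain ⟨e⟩ := h.nonempty_Q_iso
  have := hI.isKInjective
  have := hJ.isKInjective
  obtain ⟨f, hf⟩ := exists_Q_map_eq e.hom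
  have : QuasiIso f := by
    rw [← DerivedCategory.isIso_Q_map_iff_quasiIso, hf]
    infer_instance
  obtain ⟨e', -⟩ := (CochainComplex.IsKInjective.quasiIso_iff f).1 this
  exact ⟨e'⟩

/-- The differential of `I` vanishes on maximal vectors. -/
def VanishesOnMaximalVectors (I : SheafComplex k P) : Prop :=
  ∀ (d : ℤ) (π : P) (s : (I.X d).obj π),
    PosetSheaf.IsMaximalVector (I.X d) π s → (I.d d (d + 1)).app π s = 0

lemma VanishesOnMaximalVectors.d_apply {I : SheafComplex k P} (hI : VanishesOnMaximalVectors I)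
    (i j : ℤ) {π : P} {s : (I.X i).obj π} (hs : PosetSheaf.IsMaximalVector (I.X i) π s) :
    (I.d i j).app π s = 0 := by
  by_cases h : i + 1 = j
  · subst h
    exact hI i π s hs
  · rw [I.shape i j h]
    rfl

/-- Both homotopy terms vanish on a maximal vector: the differential kills it, and also kills its
image under the homotopy, which is again maximal. So each `f.f d` is mono, hence bijective by
dimension. -/
lemma VanishesOnMaximalVectors.isIso [Finite P] {I : SheafComplex k P}
    (hI : VanishesOnMaximalVectors I) {f : I ⟶ I} (h : Homotopy f (𝟙 I)) : IsIso f := by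
  have (d : ℤ) : IsIso (f.f d) := by
    have : Mono (f.f d) := by
      refine PosetSheaf.mono_of_isMaximalVector _ fun π s hs h0 => ?_
      have hc := h.comm d
      rw [dNext_eq h.hom (show (ComplexShape.up ℤ).Rel d (d + 1) from rfl),
        prevD_eq h.hom (show (ComplexShape.up ℤ).Rel (d - 1) d from sub_add_cancel d 1)] at hc
      rw [hc, PosetSheaf.add_app_apply, PosetSheaf.add_app_apply, PosetSheaf.comp_app_apply,
        PosetSheaf.comp_app_apply, hI.d_apply _ _ hs, hI.d_apply _ _ (hs.map _), map_zero,
        zero_add, zero_add] at h0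
      exact h0
    exact PosetSheaf.isIso_of_mono_of_finrank_le _ fun π => le_rfl
  exact HomologicalComplex.Hom.isIso_of_components f

lemma injective_f_of_isIso_comp {I J : SheafComplex k P} (f : I ⟶ J) (g : J ⟶ I) [IsIso (f ≫ g)]
    (d : ℤ) (π : P) : Function.Injective ((f.f d).app π) := by
  have : IsIso ((f ≫ g).f d) := inferInstance
  have : Mono (f.f d ≫ g.f d) := by
    rw [← HomologicalComplex.comp_f]
    infer_instance
  exact (PosetSheaf.mono_iff_injective _).1 (mono_of_mono _ (g.f d)) π

lemma surjective_f_of_isIso_comp {I J : SheafComplex k P} (f : I ⟶ J) (g : J ⟶ I)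
    [IsIso (f ≫ g)] (d : ℤ) (π : P) : Function.Surjective ((g.f d).app π) := by
  intro x
  refine ⟨(f.f d).app π (((inv (f ≫ g)).f d).app π x), ?_⟩
  rw [← PosetSheaf.comp_app_apply, ← PosetSheaf.comp_app_apply, ← HomologicalComplex.comp_f,
    ← HomologicalComplex.comp_f, IsIso.inv_hom_id]
  rfl

lemma VanishesOnMaximalVectors.exists_hom [Finite P] {I J : SheafComplex k P}
    (hv : VanishesOnMaximalVectors I) (hI : IsInjectiveComplex I) (hJ : IsInjectiveComplex J)
    (h : QuasiIsomorphic I J) : ∃ (q : I ⟶ J) (r : J ⟶ I), IsIso (q ≫ r) := by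
  obtain ⟨e⟩ := h.nonempty_homotopyEquiv hI hJ
  exact ⟨e.hom, e.inv, hv.isIso e.homotopyHomInvId⟩

lemma VanishesOnMaximalVectors.of_iso {I J : SheafComplex k P} (hI : VanishesOnMaximalVectors I)
    (e : I ≅ J) : VanishesOnMaximalVectors J := by
  intro d π s hs
  have h := hI d π _ (hs.map (e.inv.f d))
  have h' : (e.inv.f d ≫ I.d d (d + 1) ≫ e.hom.f (d + 1)).app π s = 0 := by
    rw [PosetSheaf.comp_app_apply, PosetSheaf.comp_app_apply, h, map_zero]
  rwa [← HomologicalComplex.Hom.comm, ← HomologicalComplex.comp_f_assoc, e.inv_hom_id,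
    HomologicalComplex.id_f, Category.id_comp] at h'

lemma VanishesOnMaximalVectors.nonempty_iso [Finite P] {I J : SheafComplex k P}
    (hv : VanishesOnMaximalVectors I) (hv' : VanishesOnMaximalVectors J)
    (hI : IsInjectiveComplex I) (hJ : IsInjectiveComplex J) (h : QuasiIsomorphic I J) :
    Nonempty (I ≅ J) := by
  obtain ⟨e⟩ := h.nonempty_homotopyEquiv hI hJ
  have h₁ : IsIso (e.hom ≫ e.inv) := hv.isIso e.homotopyHomInvId
  have h₂ : IsIso (e.inv ≫ e.hom) := hv'.isIso e.homotopyInvHomId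
  have : Mono e.hom := mono_of_mono e.hom e.inv
  have : IsSplitEpi e.hom := ⟨⟨⟨inv (e.inv ≫ e.hom) ≫ e.inv, by simp⟩⟩⟩
  have := isIso_of_mono_of_isSplitEpi e.hom
  exact ⟨asIso e.hom⟩

end SheafComplex

/-! ### Null homotopic idempotents -/

section SplitHomotopy

variable {C : Type*} [Category* C] [Preadditive C]

/-- The null homotopic endomorphism of `K` given by a single map `K.X (d + 1) ⟶ K.X d`. -/
noncomputable def CochainComplex.singleNullHomotopicMap (K : CochainComplex C ℤ) (d : ℤ)
    (h : K.X (d + 1) ⟶ K.X d) : K ⟶ K :=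
  Homotopy.nullHomotopicMap fun i j =>
    if hij : i = d + 1 ∧ j = d then
      (K.XIsoOfEq hij.1).hom ≫ h ≫ (K.XIsoOfEq hij.2.symm).hom else 0

namespace CochainComplex

variable (K : CochainComplex C ℤ) (d : ℤ) (h : K.X (d + 1) ⟶ K.X d)

lemma singleNullHomotopicMap_f (n : ℤ) :
    (singleNullHomotopicMap K d h).f n =
      K.d n (n + 1) ≫ (if hij : n + 1 = d + 1 ∧ n = d then
        (K.XIsoOfEq hij.1).hom ≫ h ≫ (K.XIsoOfEq hij.2.symm).hom else 0) +
      (if hij : n = d + 1 ∧ n - 1 = d then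
        (K.XIsoOfEq hij.1).hom ≫ h ≫ (K.XIsoOfEq hij.2.symm).hom else 0) ≫ K.d (n - 1) n := by
  dsimp only [singleNullHomotopicMap, Homotopy.nullHomotopicMap]
  rw [dNext_eq _ (show (ComplexShape.up ℤ).Rel n (n + 1) from rfl),
    prevD_eq _ (show (ComplexShape.up ℤ).Rel (n - 1) n from sub_add_cancel n 1)]

lemma singleNullHomotopicMap_f_self :
    (singleNullHomotopicMap K d h).f d = K.d d (d + 1) ≫ h := by
  rw [singleNullHomotopicMap_f, dif_pos ⟨rfl, rfl⟩, dif_neg (by omega)]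
  simp

lemma singleNullHomotopicMap_f_succ :
    (singleNullHomotopicMap K d h).f (d + 1) = h ≫ K.d d (d + 1) := by
  rw [singleNullHomotopicMap_f, dif_neg (by omega), dif_pos ⟨rfl, by omega⟩]
  simp

lemma singleNullHomotopicMap_f_of_ne {n : ℤ} (h₁ : n ≠ d) (h₂ : n ≠ d + 1) :
    (singleNullHomotopicMap K d h).f n = 0 := by
  rw [singleNullHomotopicMap_f, dif_neg (by omega), dif_neg (by omega)]
  simp

lemma singleNullHomotopicMap_idem (hh : h ≫ K.d d (d + 1) ≫ h = h) :
    singleNullHomotopicMap K d h ≫ singleNullHomotopicMap K d h =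
      singleNullHomotopicMap K d h := by
  ext n
  rw [HomologicalComplex.comp_f]
  by_cases h₁ : n = d
  · subst h₁
    rw [singleNullHomotopicMap_f_self, Category.assoc, hh]
  · by_cases h₂ : n = d + 1
    · subst h₂
      rw [singleNullHomotopicMap_f_succ, Category.assoc, reassoc_of% hh]
    · rw [singleNullHomotopicMap_f_of_ne K d h h₁ h₂, comp_zero]

/-- `singleNullHomotopicMap K d h` is homotopic to zero. -/
noncomputable def singleNullHomotopy : Homotopy (singleNullHomotopicMap K d h) 0 :=
  Homotopy.nullHomotopy _ fun i j hij => dif_neg fun h' => hij (by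
    change j + 1 = i
    omega)

end CochainComplex

end SplitHomotopy

/-! ### Splitting off contractible summands -/

namespace SheafComplex

variable {k : Type u} [Field k] {P : Type w} [PartialOrder P]

lemma IsInjectiveComplex.of_retract {I Y : SheafComplex k P} (hI : IsInjectiveComplex I)
    (e : Retract Y I) : IsInjectiveComplex Y := by
  have e' (d : ℤ) : Retract (Y.X d) (I.X d) := e.map (HomologicalComplex.eval _ _ d)
  refine ⟨?_, fun d => ?_⟩
  · obtain ⟨N, hN⟩ := hI.bounded
    refine ⟨N, fun d hd => ?_⟩
    rw [IsZero.iff_id_eq_zero, ← (e' d).retract, (hN d hd).eq_of_tgt (e' d).i 0, zero_comp]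
  · have := hI.injective d
    exact (e' d).injective

/-- If the differential does not vanish on maximal vectors, a contractible summand splits off. -/
lemma exists_retract_socleDim_lt [Finite P] {I : SheafComplex k P} (hI : IsInjectiveComplex I)
    (h : ¬ VanishesOnMaximalVectors I) :
    ∃ (Y : SheafComplex k P) (e : Retract Y I), QuasiIso e.r ∧
      ∃ d : ℤ, PosetSheaf.socleDim (Y.X d) < PosetSheaf.socleDim (I.X d) := by
  simp only [VanishesOnMaximalVectors, not_forall] at h
  obtain ⟨d, π, s, hs, h0⟩ := h
  have := hI.injective d
  obtain ⟨a, v, ha, hav⟩ := PosetSheaf.exists_indecInjective_retraction (I.d d (d + 1)) hs h0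
  -- The homotopy `v ≫ a` is a partial inverse of the differential because `a ≫ d ≫ v = 𝟙`.
  have hidem := CochainComplex.singleNullHomotopicMap_idem I d (v ≫ a)
    (by simp only [Category.assoc, reassoc_of% hav])
  have hself := CochainComplex.singleNullHomotopicMap_f_self I d (v ≫ a)
  have hnull := CochainComplex.singleNullHomotopy I d (v ≫ a)
  set N := CochainComplex.singleNullHomotopicMap I d (v ≫ a)
  -- `N` projects onto the contractible summand; `Y` is the complementary one, homotopy equivalent
  -- to `I` because `N` is null homotopic.
  obtain ⟨Y, i, r, hir, hri⟩ := IsIdempotentComplete.idempotents_split I (𝟙 I - N) (by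
    simp [Preadditive.sub_comp, Preadditive.comp_sub, hidem])
  refine ⟨Y, ⟨i, r, hir⟩, ?_, d, ?_⟩
  · let e : HomotopyEquiv I Y :=
      { hom := r
        inv := i
        homotopyHomInvId := (Homotopy.ofEq hri).trans
          (Homotopy.equivSubZero.symm
            ((Homotopy.ofEq (sub_sub_cancel (𝟙 I) N)).trans hnull)).symm
        homotopyInvHomId := Homotopy.ofEq hir }
    exact homotopyEquivalences_le_quasiIso _ _ r ⟨e, rfl⟩
  -- Without a drop in degree `d`, the vector `s` would lie in the image of `Y`, where `𝟙 I - N` is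
  -- the identity; but `𝟙 I - N` kills `s`.
  · by_contra hle
    have hird : i.f d ≫ r.f d = 𝟙 _ := by
      rw [← HomologicalComplex.comp_f, hir, HomologicalComplex.id_f]
    have : Mono (i.f d ≫ r.f d) := hird ▸ inferInstance
    have : Mono (i.f d) := mono_of_mono _ (r.f d)
    obtain ⟨y, hy⟩ := PosetSheaf.maximalVectorsMap_surjective_of_socleDim_le (i.f d)
      (not_lt.1 hle) π ⟨s, hs⟩
    have hy' : (i.f d).app π y = s := congrArg Subtype.val hy
    have hz : a ≫ r.f d ≫ i.f d = 0 := by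
      rw [← HomologicalComplex.comp_f, hri, HomologicalComplex.sub_f_apply, hself,
        HomologicalComplex.id_f, Preadditive.comp_sub, reassoc_of% hav, Category.comp_id, sub_self]
    have hs0 : (a ≫ r.f d ≫ i.f d).app π (PosetSheaf.indecInjectiveOne k π) = 0 := by
      rw [hz, PosetSheaf.zero_app_apply]
    rw [PosetSheaf.comp_app_apply, PosetSheaf.comp_app_apply, ha, ← hy',
      ← PosetSheaf.comp_app_apply (i.f d), hird, PosetSheaf.id_app_apply, hy'] at hs0
    exact h0 (by rw [hs0, map_zero])

/-- Strong induction on the total socle dimension, a finite sum by boundedness; splitting off a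
contractible summand lowers it. -/
lemma exists_vanishesOnMaximalVectors [Finite P] {I : SheafComplex k P}
    (hI : IsInjectiveComplex I) :
    ∃ (J : SheafComplex k P) (r : I ⟶ J), QuasiIso r ∧ IsInjectiveComplex J ∧
      VanishesOnMaximalVectors J := by
  obtain ⟨N, hN⟩ := hI.bounded
  induction hn : ∑ d ∈ Finset.Icc (-N) N, PosetSheaf.socleDim (I.X d)
    using Nat.strong_induction_on generalizing I with
  | _ n ih =>
    by_cases hv : VanishesOnMaximalVectors I
    · exact ⟨I, 𝟙 I, inferInstance, hI, hv⟩
    · obtain ⟨Y, e, he, d, hd⟩ := exists_retract_socleDim_lt hI hv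
      have hle (j : ℤ) : PosetSheaf.socleDim (Y.X j) ≤ PosetSheaf.socleDim (I.X j) := by
        have e' : Retract (Y.X j) (I.X j) := e.map (HomologicalComplex.eval _ _ j)
        exact PosetSheaf.socleDim_le_of_mono e'.i
      have hzero {j : ℤ} (hj : N < |j|) : PosetSheaf.socleDim (I.X j) = 0 :=
        PosetSheaf.socleDim_eq_zero_iff.2 (hN j hj)
      obtain ⟨J, r, hr, hJ, hJv⟩ := ih _ (by
        rw [← hn]
        refine Finset.sum_lt_sum (fun j _ => hle j) ⟨d, ?_, hd⟩
        rw [Finset.mem_Icc, ← abs_le]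
        by_contra hd'
        rw [hzero (not_le.1 hd')] at hd
        exact absurd hd (Nat.not_lt_zero _)) (hI.of_retract e) (fun j hj =>
          PosetSheaf.socleDim_eq_zero_iff.1 (Nat.le_zero.1 ((hle j).trans (hzero hj).le))) rfl
      exact ⟨J, e.r ≫ r, inferInstance, hJ, hJv⟩

end SheafComplex

/-! ### Acyclicity and mapping cones -/

section DerivedCategory

open Pretriangulated

variable {C : Type*} [Category* C] [Abelian C]

lemma DerivedCategory.isZero_Q_obj_iff_acyclic [HasDerivedCategory C] (K : CochainComplex C ℤ) :
    IsZero (DerivedCategory.Q.obj K) ↔ K.Acyclic := by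
  have h : IsZero (DerivedCategory.Q.obj K) ↔ QuasiIso (0 : K ⟶ K) := by
    rw [← DerivedCategory.isIso_Q_map_iff_quasiIso, Functor.map_zero,
      isIsoZero_iff_source_target_isZero,
      and_self]
  rw [h, quasiIso_iff]
  refine forall_congr' fun n => ?_
  rw [quasiIsoAt_iff_isIso_homologyMap, HomologicalComplex.homologyMap_zero,
    isIsoZero_iff_source_target_isZero, and_self, HomologicalComplex.exactAt_iff_isZero_homology]

attribute [local instance] HasDerivedCategory.standard in
lemma CochainComplex.mappingCone.acyclic_iff_quasiIso {K L : CochainComplex C ℤ} (φ : K ⟶ L) :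
    (CochainComplex.mappingCone φ).Acyclic ↔ QuasiIso φ := by
  rw [← DerivedCategory.isZero_Q_obj_iff_acyclic, ← DerivedCategory.isIso_Q_map_iff_quasiIso]
  exact Triangle.isZero₃_iff_isIso₁ _ (DerivedCategory.mappingCone_triangle_distinguished φ)

lemma HomologicalComplex.Acyclic.of_iso {K L : CochainComplex C ℤ} (hK : K.Acyclic) (e : K ≅ L) :
    L.Acyclic := fun n => (hK n).of_iso e

end DerivedCategory

/-! ### Existence of injective resolutions -/

namespace SheafComplex

variable {k : Type u} [Field k] {P : Type w} [PartialOrder P]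

/-- The complex of vector spaces `F(π)`. -/
noncomputable abbrev evalFunctor (k : Type u) [Field k] (π : P) :
    SheafComplex k P ⥤ CochainComplex (FGModuleCat.{u} k) ℤ :=
  ((evaluation P (FGModuleCat.{u} k)).obj π).mapHomologicalComplex (ComplexShape.up ℤ)

lemma acyclic_of_forall_acyclic_eval {F : SheafComplex k P}
    (h : ∀ π, ((evalFunctor k π).obj F).Acyclic) : F.Acyclic := by
  intro n
  rw [HomologicalComplex.exactAt_iff_isZero_homology]
  refine Functor.isZero _ fun π => ?_
  refine IsZero.of_iso ?_
    ((F.sc n).mapHomologyIso ((evaluation P (FGModuleCat.{u} k)).obj π)).symm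
  exact ((evalFunctor k π).obj F).exactAt_iff_isZero_homology n |>.1 (h π n)

/-- The unit morphism from `F` to the complex coinduced from `F(π)`. -/
noncomputable def toCoind (F : SheafComplex k P) (π : P) :
    F ⟶ ((PosetSheaf.coind π).mapHomologicalComplex (ComplexShape.up ℤ)).obj
      ((evalFunctor k π).obj F) :=
  (NatTrans.mapHomologicalComplex (PosetSheaf.coindAdjunction k π).unit _).app F

lemma isZero_coind_obj {π τ : P} (h : ¬ τ ≤ π) (V : FGModuleCat.{u} k) :
    IsZero (((PosetSheaf.coind π).obj V).obj τ) := by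
  rw [IsZero.iff_id_eq_zero]
  ext x
  exact PosetSheaf.coind_ext fun h' => absurd h' h

lemma isIso_unit_app (F : PosetSheaf k P) (π : P) :
    IsIso (((PosetSheaf.coindAdjunction k π).unit.app F).app π) := by
  have h (x : F.obj π) : PosetSheaf.coindEval le_rfl
      (((PosetSheaf.coindAdjunction k π).unit.app F).app π x) = x :=
    PosetSheaf.map_refl_apply x
  refine FGModuleCat.isIso_of_bijective _ ⟨fun x y hxy => ?_, fun y => ?_⟩
  · rw [← h x, hxy, h]
  · exact ⟨PosetSheaf.coindEval le_rfl y, PosetSheaf.coind_ext fun _ => h _⟩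

lemma isBounded_mappingCone {K L : SheafComplex k P} (hK : IsBounded K) (hL : IsBounded L)
    (φ : K ⟶ L) : IsBounded (CochainComplex.mappingCone φ) := by
  obtain ⟨N, hN⟩ := hK
  obtain ⟨M, hM⟩ := hL
  -- The cone in degree `d` involves `K` in degree `d + 1`, hence the shift of `N`.
  refine ⟨max (N + 1) M, fun d hd => ?_⟩
  refine HomologicalComplex.homotopyCofiber.isZero_X φ d
    (hM d (lt_of_le_of_lt (le_max_right _ _) hd))
    fun j hj => hN j ?_
  obtain rfl : d + 1 = j := hj
  have h1 := lt_of_le_of_lt (le_max_left (N + 1) M) hd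
  have := abs_sub_abs_le_abs_sub d (-1)
  rw [sub_neg_eq_add, abs_neg, abs_one] at this
  linarith

lemma IsInjectiveComplex.mappingCone {I J : SheafComplex k P} (hI : IsInjectiveComplex I)
    (hJ : IsInjectiveComplex J) (φ : I ⟶ J) :
    IsInjectiveComplex (CochainComplex.mappingCone φ) where
  bounded := isBounded_mappingCone hI.bounded hJ.bounded φ
  injective d := by
    have := hI.injective (d + 1)
    have := hJ.injective d
    exact Injective.of_iso
      (HomologicalComplex.homotopyCofiber.XIsoBiprod φ d (d + 1) rfl).symm inferInstance

lemma IsInjectiveComplex.shift {I : SheafComplex k P} (hI : IsInjectiveComplex I) (n : ℤ) :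
    IsInjectiveComplex (I⟦n⟧) where
  bounded := by
    obtain ⟨N, hN⟩ := hI.bounded
    refine ⟨N + |n|, fun d hd => hN (d + n) ?_⟩
    have := abs_sub_abs_le_abs_sub d (-n)
    rw [sub_neg_eq_add, abs_neg] at this
    linarith
  injective d := hI.injective (d + n)

attribute [local instance] HasDerivedCategory.standard

-- In the derived category `F` is the cocone of `G` mapping to the cone of `φ`. Replacing that cone
-- by `J` and lifting to a chain map `g` presents `F` as a shifted cone of injective complexes.
open Pretriangulated in
lemma exists_injective_Q_iso_of_mappingCone {F G J : SheafComplex k P} (φ : F ⟶ G)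
    (hG : IsInjectiveComplex G) (hJ : IsInjectiveComplex J)
    (e : DerivedCategory.Q.obj (CochainComplex.mappingCone φ) ≅ DerivedCategory.Q.obj J) :
    ∃ I : SheafComplex k P, IsInjectiveComplex I ∧
      Nonempty (DerivedCategory.Q.obj F ≅ DerivedCategory.Q.obj I) := by
  have := hJ.isKInjective
  obtain ⟨g, hg⟩ := exists_Q_map_eq
    (DerivedCategory.Q.map (CochainComplex.mappingCone.inr φ) ≫ e.hom)
  have hT := DerivedCategory.mappingCone_triangle_distinguished φ
  have hT' := DerivedCategory.mappingCocone_triangle_distinguished g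
  obtain ⟨a, ha₁, ha₂⟩ := complete_distinguished_triangle_morphism₁ _ _ hT hT' (𝟙 _) e.hom
    (hg.symm.trans (Category.id_comp _).symm)
  let ψ : DerivedCategory.Q.mapTriangle.obj (CochainComplex.mappingCone.triangle φ) ⟶
      DerivedCategory.Q.mapTriangle.obj (CochainComplex.mappingCocone.triangle g) :=
    { hom₁ := a
      hom₂ := 𝟙 _
      hom₃ := e.hom
      comm₁ := ha₁
      comm₂ := hg.symm.trans (Category.id_comp _).symm
      comm₃ := ha₂ }
  have ha : IsIso a := isIso₁_of_isIso₂₃ ψ hT hT' (inferInstanceAs (IsIso (𝟙 _)))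
    (inferInstanceAs (IsIso e.hom))
  exact ⟨CochainComplex.mappingCocone g, (hG.mappingCone hJ g).shift (-1), ⟨@asIso _ _ _ _ a ha⟩⟩

lemma acyclic_eval_mappingCone_iff {F G : SheafComplex k P} (φ : F ⟶ G) (π : P) :
    ((evalFunctor k π).obj (CochainComplex.mappingCone φ)).Acyclic ↔
      QuasiIso ((evalFunctor k π).map φ) := by
  rw [← CochainComplex.mappingCone.acyclic_iff_quasiIso]
  let e := CochainComplex.mappingCone.mapHomologicalComplexIso φ
    ((evaluation P (FGModuleCat.{u} k)).obj π)
  exact ⟨fun h => h.of_iso e, fun h => h.of_iso e.symm⟩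

/-- Induction on the number of points outside `U`. The cone of `toCoind F π`, for `π` maximal
outside `U`, is acyclic on `insert π U`, and its target is already injective. -/
lemma exists_injective_Q_iso [Finite P] (U : Set P) (hU : IsUpperSet U) {F : SheafComplex k P}
    (hF : IsBounded F) (h : ∀ τ ∈ U, ((evalFunctor k τ).obj F).Acyclic) :
    ∃ I : SheafComplex k P, IsInjectiveComplex I ∧
      Nonempty (DerivedCategory.Q.obj F ≅ DerivedCategory.Q.obj I) := by
  induction hn : Uᶜ.ncard generalizing U F with
  | zero =>
    have hU' (τ : P) : τ ∈ U := by
      rw [Set.ncard_eq_zero, Set.compl_empty_iff] at hn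
      exact hn ▸ Set.mem_univ τ
    obtain ⟨Z, hZ⟩ := HasZeroObject.zero (C := SheafComplex k P)
    refine ⟨Z, ⟨⟨0, fun d _ => ?_⟩, fun d => ?_⟩, ⟨IsZero.iso ?_ ?_⟩⟩
    · exact (HomologicalComplex.eval _ _ d).map_isZero hZ
    · exact ((HomologicalComplex.eval _ _ d).map_isZero hZ).injective
    · exact (DerivedCategory.isZero_Q_obj_iff_acyclic F).2
        (acyclic_of_forall_acyclic_eval fun τ => h τ (hU' τ))
    · exact DerivedCategory.Q.map_isZero hZ
  | succ n ih =>
    obtain ⟨π, hπ, hmax⟩ :=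
      (Set.toFinite Uᶜ).exists_maximal (Set.nonempty_of_ncard_ne_zero (by omega))
    have hlt {τ : P} (hτ : π < τ) : τ ∈ U := by
      by_contra hτU
      exact hτ.not_ge (hmax hτU hτ.le)
    have hG : IsInjectiveComplex (((PosetSheaf.coind π).mapHomologicalComplex
        (ComplexShape.up ℤ)).obj ((evalFunctor k π).obj F)) := by
      refine ⟨?_, fun d => inferInstanceAs (Injective ((PosetSheaf.coind π).obj _))⟩
      obtain ⟨N, hN⟩ := hF
      exact ⟨N, fun d hd => Functor.map_isZero (PosetSheaf.coind π)
        (Functor.map_isZero ((evaluation P (FGModuleCat.{u} k)).obj π) (hN d hd))⟩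
    have hU' : IsUpperSet (insert π U) := by
      rintro a b hab (rfl | ha)
      · obtain rfl | hab := eq_or_lt_of_le hab
        · exact Set.mem_insert _ _
        · exact Set.mem_insert_of_mem _ (hlt hab)
      · exact Set.mem_insert_of_mem _ (hU hab ha)
    have hac : ∀ τ ∈ insert π U, ((evalFunctor k τ).obj
        (CochainComplex.mappingCone (toCoind F π))).Acyclic := by
      intro τ hτ
      rw [acyclic_eval_mappingCone_iff]
      -- At `π` the unit is an isomorphism. At a point of `U`, which is never below `π`, the
      -- coinduced complex is zero and `F` is acyclic.
      by_cases hτπ : τ = π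
      · subst hτπ
        have (d : ℤ) : IsIso (((evalFunctor k τ).map (toCoind F τ)).f d) :=
          isIso_unit_app (F.X d) τ
        have := HomologicalComplex.Hom.isIso_of_components ((evalFunctor k τ).map (toCoind F τ))
        infer_instance
      · have hτU : τ ∈ U := hτ.resolve_left hτπ
        have hle : ¬ τ ≤ π := fun hle => hπ (hU hle hτU)
        rw [← DerivedCategory.isIso_Q_map_iff_quasiIso]
        refine IsZero.isIso ?_ ?_ _
        · exact (DerivedCategory.isZero_Q_obj_iff_acyclic _).2 (h τ hτU)
        · refine DerivedCategory.Q.map_isZero ?_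
          rw [IsZero.iff_id_eq_zero]
          ext d : 1
          exact (isZero_coind_obj hle _).eq_of_src _ _
    have hcard : (insert π U)ᶜ.ncard = n := by
      have : Uᶜ = insert π (insert π U)ᶜ := by
        ext τ
        by_cases hτ : τ = π
        · subst hτ; simpa using hπ
        · simp [hτ]
      rw [this, Set.ncard_insert_of_notMem (by simp)] at hn
      omega
    obtain ⟨J, hJ, ⟨e⟩⟩ := ih (insert π U) hU' (isBounded_mappingCone hF hG.bounded (toCoind F π))
      hac hcard
    exact exists_injective_Q_iso_of_mappingCone _ hG hJ e

lemma exists_isInjectiveResolution [Finite P] {F : SheafComplex k P} (hF : IsBounded F) :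
    ∃ (I : SheafComplex k P) (α : F ⟶ I), IsInjectiveResolution α := by
  obtain ⟨I, hI, ⟨e⟩⟩ := exists_injective_Q_iso ∅ isUpperSet_empty hF (by simp)
  have := hI.isKInjective
  obtain ⟨α, hα⟩ := exists_Q_map_eq e.hom
  refine ⟨I, α, hI, ?_⟩
  rw [← DerivedCategory.isIso_Q_map_iff_quasiIso, hα]
  infer_instance

end SheafComplex

/-! ### Equivalence of the four conditions -/

namespace SheafComplex

variable {k : Type u} [Field k] {P : Type w} [PartialOrder P]

lemma isIso_of_injective_of_finrank_le {I J : SheafComplex k P} (f : I ⟶ J)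
    (hf : ∀ (d : ℤ) (π : P), Function.Injective ((f.f d).app π))
    (h : ∀ (d : ℤ) (π : P),
      Module.finrank k ((J.X d).obj π) ≤ Module.finrank k ((I.X d).obj π)) : IsIso f := by
  have (d : ℤ) : IsIso (f.f d) := by
    have : Mono (f.f d) := (PosetSheaf.mono_iff_injective _).2 (hf d)
    exact PosetSheaf.isIso_of_mono_of_finrank_le _ (h d)
  exact HomologicalComplex.Hom.isIso_of_components f

lemma isIso_of_surjective_of_finrank_le {I J : SheafComplex k P} (f : I ⟶ J)
    (hf : ∀ (d : ℤ) (π : P), Function.Surjective ((f.f d).app π))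
    (h : ∀ (d : ℤ) (π : P),
      Module.finrank k ((I.X d).obj π) ≤ Module.finrank k ((J.X d).obj π)) : IsIso f := by
  have (d : ℤ) : IsIso (f.f d) := PosetSheaf.isIso_of_surjective_of_finrank_le _ (hf d) (h d)
  exact HomologicalComplex.Hom.isIso_of_components f

lemma VanishesOnMaximalVectors.isMinimal [Finite P] {I : SheafComplex k P}
    (hv : VanishesOnMaximalVectors I) (hI : IsInjectiveComplex I) : IsMinimal I := by
  refine ⟨hI, fun J hJ h d => ?_⟩
  obtain ⟨q, r, _⟩ := hv.exists_hom hI hJ h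
  have := hI.injective d
  have := hJ.injective d
  rw [PosetSheaf.numIndecomposableSummands_eq_socleDim,
    PosetSheaf.numIndecomposableSummands_eq_socleDim]
  have : Mono (q.f d) := (PosetSheaf.mono_iff_injective _).2 (injective_f_of_isIso_comp q r d)
  exact PosetSheaf.socleDim_le_of_mono (q.f d)

/-- A reduced complex `J` embeds in `I` degreewise, and minimality bounds the socle dimension of `I`
by that of `J`, so the embedding is an isomorphism. -/
lemma IsMinimal.vanishesOnMaximalVectors [Finite P] {I : SheafComplex k P} (hI : IsMinimal I) :
    VanishesOnMaximalVectors I := by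
  obtain ⟨J, r, hr, hJ, hv⟩ := exists_vanishesOnMaximalVectors hI.isInjectiveComplex
  have h := QuasiIsomorphic.of_quasiIso hI.isInjectiveComplex.bounded hJ.bounded r hr
  obtain ⟨q, r, _⟩ := hv.exists_hom hJ hI.isInjectiveComplex h.symm
  have (d : ℤ) : IsIso (q.f d) := by
    have := hI.isInjectiveComplex.injective d
    have := hJ.injective d
    have : Mono (q.f d) := (PosetSheaf.mono_iff_injective _).2 (injective_f_of_isIso_comp q r d)
    refine PosetSheaf.isIso_of_mono_of_socleDim_le (q.f d) ?_
    rw [← PosetSheaf.numIndecomposableSummands_eq_socleDim,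
      ← PosetSheaf.numIndecomposableSummands_eq_socleDim]
    exact hI.le J hJ h d
  have := HomologicalComplex.Hom.isIso_of_components q
  exact hv.of_iso (asIso q)

lemma exists_minimal_isInjectiveResolution [Finite P] {F : SheafComplex k P}
    (hF : IsBounded F) :
    ∃ (I : SheafComplex k P) (α : F ⟶ I), IsInjectiveResolution α ∧ IsMinimal I := by
  obtain ⟨I, α, hα⟩ := exists_isInjectiveResolution hF
  obtain ⟨J, r, hr, hJ, hv⟩ := exists_vanishesOnMaximalVectors hα.isInjectiveComplex
  have := hα.quasiIso
  exact ⟨J, α ≫ r, ⟨hJ, inferInstance⟩, hv.isMinimal hJ⟩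

lemma QuasiIsomorphic.symm {I J : SheafComplex k P} (h : QuasiIsomorphic I J) :
    QuasiIsomorphic J I :=
  Relation.EqvGen.symm _ _ h

/-- The reduced complex `J` both embeds in `I` and surjects onto it, so pointwise dimensions agree
and the surjection is an isomorphism. -/
lemma vanishesOnMaximalVectors_of_exists_surjective [Finite P] {I : SheafComplex k P}
    (hI : IsInjectiveComplex I)
    (h : ∀ J : SheafComplex k P, IsInjectiveComplex J → QuasiIsomorphic I J →
      ∃ r : J ⟶ I, ∀ (d : ℤ) (π : P), Function.Surjective ((r.f d).app π)) :
    VanishesOnMaximalVectors I := by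
  obtain ⟨J, f, hf, hJ, hv⟩ := exists_vanishesOnMaximalVectors hI
  have hIJ := QuasiIsomorphic.of_quasiIso hI.bounded hJ.bounded f hf
  obtain ⟨r, hr⟩ := h J hJ hIJ
  obtain ⟨q, p, _⟩ := hv.exists_hom hJ hI hIJ.symm
  have := isIso_of_surjective_of_finrank_le r hr fun d π =>
    LinearMap.finrank_le_finrank_of_injective (f := ((q.f d).app π).hom.hom)
      (injective_f_of_isIso_comp q p d π)
  exact hv.of_iso (asIso r)

lemma vanishesOnMaximalVectors_of_exists_injective [Finite P] {I : SheafComplex k P}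
    (hI : IsInjectiveComplex I)
    (h : ∀ J : SheafComplex k P, IsInjectiveComplex J → QuasiIsomorphic I J →
      ∃ q : I ⟶ J, ∀ (d : ℤ) (π : P), Function.Injective ((q.f d).app π)) :
    VanishesOnMaximalVectors I := by
  obtain ⟨J, f, hf, hJ, hv⟩ := exists_vanishesOnMaximalVectors hI
  have hIJ := QuasiIsomorphic.of_quasiIso hI.bounded hJ.bounded f hf
  obtain ⟨q, hq⟩ := h J hJ hIJ
  obtain ⟨p, r, _⟩ := hv.exists_hom hJ hI hIJ.symm
  have := isIso_of_injective_of_finrank_le q hq fun d π =>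
    LinearMap.finrank_le_finrank_of_injective (f := ((p.f d).app π).hom.hom)
      (injective_f_of_isIso_comp p r d π)
  exact hv.of_iso (asIso q).symm

end SheafComplex

theorem mainTheorem3 (k : Type u) [Field k] (P : Type w) [PartialOrder P] [Finite P] :
    (∀ I : SheafComplex k P, SheafComplex.IsInjectiveComplex I →
      List.TFAE
        [SheafComplex.IsMinimal I,
          ∀ J : SheafComplex k P, SheafComplex.IsInjectiveComplex J →
            SheafComplex.QuasiIsomorphic I J →
              ∃ r : J ⟶ I, ∀ (d : ℤ) (π : P), Function.Surjective ((r.f d).app π),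
          ∀ J : SheafComplex k P, SheafComplex.IsInjectiveComplex J →
            SheafComplex.QuasiIsomorphic I J →
              ∃ q : I ⟶ J, ∀ (d : ℤ) (π : P), Function.Injective ((q.f d).app π),
          ∀ (d : ℤ) (π : P) (s : (I.X d).obj π),
            PosetSheaf.IsMaximalVector (I.X d) π s → (I.d d (d + 1)).app π s = 0]) ∧
    (∀ F : SheafComplex k P, SheafComplex.IsBounded F →
      (∃ (I : SheafComplex k P) (α : F ⟶ I),
        SheafComplex.IsInjectiveResolution α ∧ SheafComplex.IsMinimal I) ∧
      (∀ (I J : SheafComplex k P) (α : F ⟶ I) (β : F ⟶ J),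
        SheafComplex.IsInjectiveResolution α → SheafComplex.IsMinimal I →
        SheafComplex.IsInjectiveResolution β → SheafComplex.IsMinimal J →
          Nonempty (I ≅ J))) := by
  refine ⟨fun I hI => ?_, fun F hF => ⟨SheafComplex.exists_minimal_isInjectiveResolution hF,
    fun I J α β hα hI hβ hJ => ?_⟩⟩
  · tfae_have 1 → 4 := fun h => h.vanishesOnMaximalVectors
    tfae_have 4 → 1 := fun h => SheafComplex.VanishesOnMaximalVectors.isMinimal h hI
    tfae_have 4 → 2 := fun h J hJ hIJ => by
      obtain ⟨q, r, _⟩ := SheafComplex.VanishesOnMaximalVectors.exists_hom h hI hJ hIJ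
      exact ⟨r, SheafComplex.surjective_f_of_isIso_comp q r⟩
    tfae_have 4 → 3 := fun h J hJ hIJ => by
      obtain ⟨q, r, _⟩ := SheafComplex.VanishesOnMaximalVectors.exists_hom h hI hJ hIJ
      exact ⟨q, SheafComplex.injective_f_of_isIso_comp q r⟩
    tfae_have 2 → 4 := SheafComplex.vanishesOnMaximalVectors_of_exists_surjective hI
    tfae_have 3 → 4 := SheafComplex.vanishesOnMaximalVectors_of_exists_injective hI
    tfae_finish
  · have h₁ := SheafComplex.QuasiIsomorphic.of_quasiIso hF hα.isInjectiveComplex.bounded α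
      hα.quasiIso
    have h₂ := SheafComplex.QuasiIsomorphic.of_quasiIso hF hβ.isInjectiveComplex.bounded β
      hβ.quasiIso
    exact hI.vanishesOnMaximalVectors.nonempty_iso hJ.vanishesOnMaximalVectors
      hα.isInjectiveComplex hβ.isInjectiveComplex (h₁.symm.trans _ _ _ h₂)
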